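/- Let $k$ be a field of prime characteristic $p$, and let $R=\bigoplus_{n\ge 0}R_n$ be a finitely generated, positively graded commutative $k$-algebra, i.e. $R$ is finitely generated as a $k$-algebra, $\mathbb N$-graded, and $R_0=k$ (the algebra generators may have arbitrary positive degrees). Let $d=\dim R$ be the Krull dimension of $R$ and let $I\subseteq R$ be a homogeneous ideal of height $d-1$. For an ideal $J\subseteq R$ and $q=p^e$ with $e\ge 0$, let $J^{[q]}$ denote the $q$-th Frobenius power of $J$, the ideal generated by the $q$-th powers of the elements (equivalently, of any set of generators) of $J$. Then the Frobenius powers of $I$ have linear growth of primary decompositions: there is a natural number $c$ such that for every $q=p^e$, $e\ge 0$, there are an integer $r$ and primary ideals $Q_1,\dots,Q_r$ of $R$ (all depending on $q$) with $$I^{[q]}=Q_1\cap Q_2\cap\cdots\cap Q_r\qquad\text{and}\qquad \bigl((\sqrt{Q_i})^{c}\bigr)^{[q]}\subseteq Q_i\quad\text{for all } i=1,\dots,r.$$ -/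

import Mathlib

/-- The bracket power `I^{[n]}`: the ideal generated by the `n`-th powers of the elements of `I`.
For `n = p ^ e` in characteristic `p` this is the Frobenius power, and the `n`-th powers of any
set of generators of `I` generate it, see `frobeniusPower_span`. -/
def frobeniusPower {R : Type*} [CommRing R] (I : Ideal R) (n : ℕ) : Ideal R :=
  Ideal.span ((fun x : R => x ^ n) '' (I : Set R))

theorem frobeniusPower_span {R : Type*} [CommRing R] (p : ℕ) [Fact p.Prime] [CharP R p]
    (e : ℕ) (S : Set R) :
    frobeniusPower (Ideal.span S) (p ^ e) = Ideal.span ((fun x : R => x ^ p ^ e) '' S) := by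
  have h : ∀ J : Ideal R, frobeniusPower J (p ^ e) = J.map (iterateFrobenius R p e) :=
    fun _ => rfl
  rw [h, Ideal.map_span]
  rfl

/-- The Frobenius powers of `I` have linear growth of primary decompositions: there is a `c`,
independent of `q = p ^ e`, such that every `I^{[q]}` has a primary decomposition
`Q₁ ∩ ⋯ ∩ Qᵣ` with `(√Qᵢ)^{c[q]} = ((√Qᵢ)^c)^{[q]} ⊆ Qᵢ` for all `i`. -/
def HasLinearGrowthOfPrimaryDecompositions {R : Type*} [CommRing R] (p : ℕ) (I : Ideal R) :
    Prop :=
  ∃ c : ℕ, ∀ e : ℕ, ∃ (r : ℕ) (Q : Fin r → Ideal R),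
    (∀ i, (Q i).IsPrimary) ∧
    frobeniusPower I (p ^ e) = ⨅ i, Q i ∧
    ∀ i, frobeniusPower ((Q i).radical ^ c) (p ^ e) ≤ Q i

/-! Let `M` be the irrelevant ideal, which is maximal, and choose a homogeneous `y` of positive
degree such that `I + (y)` contains a power of `M`; it exists because `I` has coheight one. At a
minimal prime `P ≠ M`, use the contraction of the localization of `I^{[q]}`. Growth there is easy:
if `s x ∈ I` with `s ∉ P`, then `s^q x^q ∈ I^{[q]}`. At `M`, use `I^{[q]} + (M^c)^{[q]}`.

It remains to see that these ideals intersect in `I^{[q]}`. By homogeneity of associated primes, an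
element of all components at the `P ≠ M` is killed by a power of `y` modulo `I^{[q]}`
(`mem_comap_map_away_of_forall_minimalPrimes`). Modulo `I^{[q]}`, membership in the `M`-component
removes the degrees below `c q`. So everything rests on a linear bound: the `y`-power torsion of
`R/(f_i^q)` vanishes in degrees at least a constant times `q`
(`exists_forall_mem_span_range_pow_of_pow_mul_mem`).

For generators `f_i` and `y` of one common degree, `R` is a finite module over `k[X_i][Y]`. On a
free module `Y` is a nonzerodivisor modulo `(X_i^q)`; the relations of `R` are controlled by a
single use of Artin–Rees, whose constant does not depend on `q`. High degree translates into depth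
in the `(X_i, Y)`-adic filtration. Arbitrary degrees are reduced to this case by passing to powers
of the generators. The characteristic enters only to make the `f_i^q` generate `I^{[q]}`. -/

/-! ### Uniform Artin–Rees control over a polynomial ring. -/

theorem Ideal.mem_smul_top_pi_iff {A ι : Type*} [CommRing A] [Finite ι] (I : Ideal A) (a : ι → A) :
    a ∈ I • (⊤ : Submodule A (ι → A)) ↔ ∀ i, a i ∈ I := by
  classical
  cases nonempty_fintype ι
  refine ⟨fun h i => ?_, fun h => ?_⟩
  · have := Submodule.mem_map_of_mem (f := LinearMap.proj (R := A) (φ := fun _ : ι => A) i) h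
    rw [Submodule.map_smul''] at this
    have h' : a i ∈ I * ⊤ := Submodule.smul_mono le_rfl le_top this
    rwa [Ideal.mul_top] at h'
  · rw [pi_eq_sum_univ' a]
    exact Submodule.sum_mem _ fun i _ => Submodule.smul_mem_smul (h i) Submodule.mem_top

open Polynomial in
/-- `X` is a nonzerodivisor on a finite free `B[X]`-module modulo an ideal extended from `B`. -/
theorem Polynomial.mem_map_C_smul_top_of_X_pow_smul_mem {B : Type*} [CommRing B] {ι : Type*}
    [Finite ι] (J : Ideal B) (N : ℕ) (a : ι → B[X])
    (h : (X ^ N : B[X]) • a ∈ J.map C • (⊤ : Submodule B[X] (ι → B[X]))) :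
    a ∈ J.map C • (⊤ : Submodule B[X] (ι → B[X])) := by
  rw [Ideal.mem_smul_top_pi_iff] at *
  intro i
  rw [Ideal.mem_map_C_iff]
  intro n
  have := Ideal.mem_map_C_iff.1 (h i) (n + N)
  rwa [Pi.smul_apply, smul_eq_mul, coeff_X_pow_mul] at this

open Polynomial in
/-- Let `M` be a finite `B[X]`-module. Deep in the `(𝔤, X)`-adic filtration,
multiplication by powers of `X` is injective modulo `J M`, with control which is uniform in the
ideal `J` of `B`. -/
theorem Polynomial.exists_forall_mem_smul_top_of_X_pow_smul_mem {B M : Type*} [CommRing B]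
    [IsNoetherianRing B] [AddCommGroup M] [Module B[X] M] [Module.Finite B[X] M] (𝔤 : Ideal B) :
    ∃ k₀ : ℕ, ∀ (J : Ideal B) (q t N j l : ℕ), J ≤ 𝔤 ^ q → 𝔤 ^ t ≤ J → k₀ + t ≤ j →
      j + N ≤ l + q → ∀ x ∈ (𝔤.map C ⊔ Ideal.span {X}) ^ j • (⊤ : Submodule B[X] M),
      (X ^ N : B[X]) • x ∈ J.map C • (𝔤.map C ⊔ Ideal.span {X}) ^ l • (⊤ : Submodule B[X] M) →
      x ∈ J.map C • (⊤ : Submodule B[X] M) := by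
  obtain ⟨s, π, hπ⟩ := Module.Finite.exists_fin' B[X] M
  set 𝔫 : Ideal B[X] := 𝔤.map C ⊔ Ideal.span {X} with h𝔫
  -- Artin–Rees for the relation module inside the free module. It is applied before `J` is
  -- introduced, so `k₀` is uniform in `J`.
  obtain ⟨k₀, hk₀⟩ := Ideal.exists_pow_inf_eq_pow_smul 𝔫 (LinearMap.ker π)
  refine ⟨k₀, fun J q t N j l hJq htJ hj hl x hx hNx => ?_⟩
  have hmap : ∀ (I : Ideal B[X]), I • (⊤ : Submodule B[X] M) = (I • ⊤ : Submodule B[X] _).map π :=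
    fun I => by rw [Submodule.map_smul'', Submodule.map_top, LinearMap.range_eq_top.2 hπ]
  rw [hmap] at hx
  obtain ⟨a, ha, rfl⟩ := hx
  rw [hmap, ← Submodule.map_smul''] at hNx
  obtain ⟨v, hv, hva⟩ := hNx
  have hJn : J.map C ≤ 𝔫 ^ q := by
    refine (Ideal.map_mono hJq).trans ?_
    rw [Ideal.map_pow]
    exact Ideal.pow_right_mono le_sup_left q
  have hXn : (X : B[X]) ∈ 𝔫 := Ideal.mem_sup_right (Ideal.mem_span_singleton_self X)
  have h1 : (X ^ N : B[X]) • a - v ∈ 𝔫 ^ (j + N) • (⊤ : Submodule B[X] (Fin s → B[X])) := by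
    refine sub_mem ?_ ?_
    · rw [add_comm, pow_add, Submodule.mul_smul]
      exact Submodule.smul_mem_smul (Ideal.pow_mem_pow hXn N) ha
    · have : v ∈ 𝔫 ^ (l + q) • (⊤ : Submodule B[X] (Fin s → B[X])) := by
        rw [add_comm, pow_add, Submodule.mul_smul]
        exact Submodule.smul_mono_left hJn hv
      exact Submodule.smul_mono_left (Ideal.pow_le_pow_right hl) this
  -- The lift `X^N a - v` is a relation lying deep in the filtration, so it is a combination of
  -- relations with coefficients in `𝔫^(t+N)`.
  have h2 : (X ^ N : B[X]) • a - v ∈ 𝔫 ^ (t + N) • LinearMap.ker π := by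
    have h3 : (X ^ N : B[X]) • a - v ∈ 𝔫 ^ (j + N) • ⊤ ⊓ LinearMap.ker π :=
      ⟨h1, by simp [hva]⟩
    rw [hk₀ _ (by omega)] at h3
    exact Submodule.smul_mono (Ideal.pow_le_pow_right (by omega)) inf_le_right h3
  -- Such coefficients lie in `J + (X^N)`. The relation is thus `u + X^N κ` with `u` in `J` times
  -- relations and `κ` a relation; replacing `a` by `a - κ` keeps its image and leaves a statement
  -- in the free module.
  have h3 : 𝔫 ^ (t + N) ≤ J.map C ⊔ Ideal.span {X ^ N} := by
    refine Ideal.sup_pow_add_le_pow_sup_pow.trans (sup_le_sup ?_ ?_)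
    · rw [← Ideal.map_pow]
      exact Ideal.map_mono htJ
    · rw [Ideal.span_singleton_pow]
  have h4 := Submodule.smul_mono_left h3 h2
  rw [Submodule.sup_smul, Submodule.ideal_span_singleton_smul] at h4
  obtain ⟨u, hu, z, hz, huz⟩ := Submodule.mem_sup.1 h4
  obtain ⟨κ, hκ, rfl⟩ := (Submodule.mem_smul_pointwise_iff_exists _ _ _).1 hz
  have h5 : (X ^ N : B[X]) • (a - κ) ∈ J.map C • (⊤ : Submodule B[X] (Fin s → B[X])) := by
    have : (X ^ N : B[X]) • (a - κ) = u + v := by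
      rw [smul_sub, sub_eq_iff_eq_add, add_right_comm, huz, sub_add_cancel]
    rw [this]
    exact add_mem (Submodule.smul_mono le_rfl le_top hu) (Submodule.smul_mono le_rfl le_top hv)
  have h6 := Submodule.mem_map_of_mem (f := π) (mem_map_C_smul_top_of_X_pow_smul_mem J N _ h5)
  rw [← hmap, map_sub, LinearMap.mem_ker.1 hκ, sub_zero] at h6
  exact h6

open Polynomial in
/-- The version of `Polynomial.exists_forall_mem_smul_top_of_X_pow_smul_mem` for a finite ring
homomorphism. -/
theorem Polynomial.exists_forall_mem_map_of_X_pow_mul_mem {B R : Type*} [CommRing B]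
    [IsNoetherianRing B] [CommRing R] (φ : B[X] →+* R) (hφ : φ.Finite) (𝔤 : Ideal B) :
    ∃ k₀ : ℕ, ∀ (J : Ideal B) (q t N j l : ℕ), J ≤ 𝔤 ^ q → 𝔤 ^ t ≤ J → k₀ + t ≤ j →
      j + N ≤ l + q → ∀ x ∈ (𝔤.map (φ.comp C) ⊔ Ideal.span {φ X}) ^ j,
      φ X ^ N * x ∈ J.map (φ.comp C) * (𝔤.map (φ.comp C) ⊔ Ideal.span {φ X}) ^ l →
      x ∈ J.map (φ.comp C) := by
  algebraize [φ]
  obtain ⟨k₀, hk₀⟩ := Polynomial.exists_forall_mem_smul_top_of_X_pow_smul_mem (M := R) 𝔤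
  refine ⟨k₀, fun J q t N j l hJq htJ hj hl x hx hNx => ?_⟩
  have h := hk₀ J q t N j l hJq htJ hj hl x
  rw [← Submodule.mul_smul] at h
  have h𝔫 : (𝔤.map C ⊔ Ideal.span {X}).map (algebraMap B[X] R) =
      𝔤.map (φ.comp C) ⊔ Ideal.span {φ X} := by
    rw [Ideal.map_sup, Ideal.map_map, Ideal.map_span, Set.image_singleton]; rfl
  simp only [Ideal.smul_top_eq_map, Submodule.restrictScalars_mem, Ideal.map_pow, Ideal.map_mul,
    Algebra.smul_def, map_pow, h𝔫, Ideal.map_map] at h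
  exact h hx hNx

/-! ### Homogeneous primes and homogeneous prime avoidance. -/

section Graded

open DirectSum

variable {k R : Type*} [Field k] [CommRing R] [Algebra k R] {𝒜 : ℕ → Submodule k R}
  [GradedAlgebra 𝒜]

theorem Ideal.IsHomogeneous.le_irrelevant (h_zero : ∀ x ∈ 𝒜 0, ∃ a : k, algebraMap k R a = x)
    {J : Ideal R} (hJ : J.IsHomogeneous 𝒜) (hJt : J ≠ ⊤) :
    J ≤ (HomogeneousIdeal.irrelevant 𝒜).toIdeal := by
  intro x hx
  rw [HomogeneousIdeal.mem_iff, HomogeneousIdeal.mem_irrelevant_iff, GradedRing.proj_apply]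
  obtain ⟨a, ha⟩ := h_zero _ (decompose 𝒜 x 0).2
  by_contra h0
  have ha0 : a ≠ 0 := by
    rintro rfl
    exact h0 (by rw [← ha, map_zero])
  refine hJt (Ideal.eq_top_of_isUnit_mem J (hJ 0 hx) ?_)
  rw [← ha]
  exact (IsUnit.mk0 a ha0).map _

theorem irrelevant_isMaximal [Nontrivial R]
    (h_zero : ∀ x ∈ 𝒜 0, ∃ a : k, algebraMap k R a = x) :
    (HomogeneousIdeal.irrelevant 𝒜).toIdeal.IsMaximal := by
  rw [Ideal.isMaximal_iff]
  constructor
  · rw [HomogeneousIdeal.mem_iff, HomogeneousIdeal.mem_irrelevant_iff, GradedRing.proj_apply,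
      decompose_of_mem_same 𝒜 SetLike.GradedOne.one_mem]
    exact one_ne_zero
  · intro J x hJ hx hxJ
    obtain ⟨a, ha⟩ := h_zero _ (decompose 𝒜 x 0).2
    have ha0 : a ≠ 0 := by
      rintro rfl
      refine hx ?_
      rw [HomogeneousIdeal.mem_iff, HomogeneousIdeal.mem_irrelevant_iff, GradedRing.proj_apply,
        ← ha, map_zero]
    have h1 : x - algebraMap k R a ∈ J := by
      refine hJ ?_
      rw [HomogeneousIdeal.mem_iff, HomogeneousIdeal.mem_irrelevant_iff, GradedRing.proj_apply,
        decompose_sub, DirectSum.sub_apply, AddSubgroupClass.coe_sub, ha,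
        decompose_of_mem_same 𝒜 (decompose 𝒜 x 0).2, sub_self]
    have h2 : algebraMap k R a ∈ J := by simpa using J.sub_mem hxJ h1
    have h3 := J.mul_mem_left (algebraMap k R a⁻¹) h2
    rwa [← map_mul, inv_mul_cancel₀ ha0, map_one] at h3

/-- The homogeneous core of a prime is prime and still contains `J`, so minimality forces it to be
the whole prime. -/
theorem Ideal.IsHomogeneous.of_mem_minimalPrimes {J P : Ideal R} (hJ : J.IsHomogeneous 𝒜)
    (hP : P ∈ J.minimalPrimes) : P.IsHomogeneous 𝒜 := by
  have h1 : P ≤ (P.homogeneousCore 𝒜).toIdeal := by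
    refine hP.2 ⟨hP.1.1.homogeneousCore, ?_⟩ (Ideal.toIdeal_homogeneousCore_le 𝒜 P)
    rw [← hJ.toIdeal_homogeneousCore_eq_self]
    exact Ideal.homogeneousCore_mono 𝒜 hP.1.2
  rw [Ideal.IsHomogeneous.iff_eq]
  exact le_antisymm (Ideal.toIdeal_homogeneousCore_le 𝒜 P) h1

theorem coe_decompose_mul_add_of_forall_lt {s x : R} {l m : ℕ}
    (hs : ∀ i, l < i → (decompose 𝒜 s i : R) = 0) (hx : ∀ i, m < i → (decompose 𝒜 x i : R) = 0) :
    (decompose 𝒜 (s * x) (l + m) : R) = decompose 𝒜 s l * decompose 𝒜 x m := by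
  rw [decompose_mul, coe_mul_apply_eq_sum_antidiagonal]
  rw [Finset.sum_eq_single (l, m)]
  · rintro ⟨i, j⟩ hij hne
    rw [Finset.HasAntidiagonal.mem_antidiagonal] at hij
    simp only at hij
    rcases lt_trichotomy i l with h | rfl | h
    · rw [hx j (by omega), mul_zero]
    · exact absurd (by rw [show j = m by omega]) hne
    · rw [hs i h, zero_mul]
  · simp

theorem decompose_eq_zero_of_lt_of_forall (s : R) :
    ∃ n, ∀ i, n ≤ i → (decompose 𝒜 s i : R) = 0 := by
  classical
  refine ⟨(decompose 𝒜 s).support.sup id + 1, fun i hi => ?_⟩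
  by_contra h
  have : i ∈ (decompose 𝒜 s).support := by
    rw [DFinsupp.mem_support_iff]
    exact fun h' => h (by rw [h']; rfl)
  have := Finset.le_sup (f := id) this
  simp only [id] at this
  omega

/-- If `s x` lies in the homogeneous ideal `T`, then some power of the top component of `s`
multiplies `x` into `T`. -/
theorem Ideal.IsHomogeneous.exists_top_pow_mul_mem {T : Ideal R} (hT : T.IsHomogeneous 𝒜)
    {s : R} {l : ℕ} (hs : ∀ i, l < i → (decompose 𝒜 s i : R) = 0) (x : R) (hsx : s * x ∈ T) :
    ∃ m, (decompose 𝒜 s l : R) ^ m * x ∈ T := by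
  obtain ⟨n, hn⟩ := decompose_eq_zero_of_lt_of_forall (𝒜 := 𝒜) x
  set t : R := ((decompose 𝒜 s l : 𝒜 l) : R)
  -- Induction on a strict bound for the degrees of `x`. The power `t^j` is carried along because
  -- removing the top component of `x` costs one more factor `t` each time.
  suffices H : ∀ n j (x : R), (∀ i, n ≤ i → (decompose 𝒜 x i : R) = 0) → s * (t ^ j * x) ∈ T →
      ∃ m, t ^ m * x ∈ T from H n 0 x hn (by simpa using hsx)
  clear hn hsx x n
  intro n
  induction n with
  | zero =>
    intro j x hx _
    refine ⟨0, ?_⟩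
    rw [hT.mem_iff]
    intro i
    rw [pow_zero, one_mul, hx i (Nat.zero_le i)]
    exact T.zero_mem
  | succ n ih =>
    intro j x hx hsx
    have htj : t ^ j ∈ 𝒜 (j * l) := SetLike.pow_mem_graded j (decompose 𝒜 s l).2
    -- The top component of `s * (t^j * x)` is `t^(j+1)` times the degree `n` component of `x`, and
    -- it lies in `T` by homogeneity.
    have h1 : t ^ (j + 1) * (decompose 𝒜 x n : R) ∈ T := by
      have h2 : ∀ i, j * l + n < i → (decompose 𝒜 (t ^ j * x) i : R) = 0 := by
        intro i hi
        rw [coe_decompose_mul_of_left_mem_of_le 𝒜 htj (by omega), hx _ (by omega), mul_zero]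
      have h3 := hT (l + (j * l + n)) hsx
      rw [coe_decompose_mul_add_of_forall_lt hs h2, coe_decompose_mul_add_of_left_mem 𝒜 htj,
        ← mul_assoc, ← pow_succ'] at h3
      exact h3
    have h4 : ∀ i, n ≤ i → (decompose 𝒜 (x - decompose 𝒜 x n) i : R) = 0 := by
      intro i hi
      rw [decompose_sub, DirectSum.sub_apply, AddSubgroupClass.coe_sub]
      rcases hi.eq_or_lt with rfl | hi
      · rw [decompose_of_mem_same 𝒜 (decompose 𝒜 x n).2, sub_self]
      · rw [decompose_of_mem_ne 𝒜 (decompose 𝒜 x n).2 hi.ne, hx i hi, sub_zero]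
    have h5 : s * (t ^ (j + 1) * (x - decompose 𝒜 x n)) ∈ T := by
      have : s * (t ^ (j + 1) * (x - decompose 𝒜 x n)) = t * (s * (t ^ j * x)) -
          s * (t ^ (j + 1) * decompose 𝒜 x n) := by ring
      rw [this]
      exact sub_mem (T.mul_mem_left _ hsx) (T.mul_mem_left _ h1)
    obtain ⟨m, hm⟩ := ih (j + 1) _ h4 h5
    refine ⟨m + (j + 1), ?_⟩
    have : t ^ (m + (j + 1)) * x = t ^ (j + 1) * (t ^ m * (x - decompose 𝒜 x n)) +
        t ^ m * (t ^ (j + 1) * decompose 𝒜 x n) := by ring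
    rw [this]
    exact add_mem (T.mul_mem_left _ hm) (T.mul_mem_left _ h1)

/-- The associated primes of a homogeneous ideal are homogeneous. -/
theorem Ideal.IsHomogeneous.of_forall_mem_iff_mul_mem {T P : Ideal R} (hT : T.IsHomogeneous 𝒜)
    (hP : P.IsPrime) (x : R) (hx : ∀ s, s ∈ P ↔ s * x ∈ T) : P.IsHomogeneous 𝒜 := by
  have key : ∀ n, ∀ s ∈ P, (∀ i, n ≤ i → (decompose 𝒜 s i : R) = 0) →
      ∀ i, (decompose 𝒜 s i : R) ∈ P := by
    intro n
    induction n with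
    | zero =>
      intro s _ h i
      rw [h i (Nat.zero_le i)]
      exact P.zero_mem
    | succ n ih =>
      intro s hs h i
      obtain ⟨m, hm⟩ := hT.exists_top_pow_mul_mem (fun i hi => h i hi) x ((hx s).1 hs)
      have hn := hP.mem_of_pow_mem m ((hx _).2 hm)
      have h2 := ih (s - decompose 𝒜 s n) (sub_mem hs hn) (fun i hi => by
        rw [decompose_sub, DirectSum.sub_apply, AddSubgroupClass.coe_sub]
        rcases hi.eq_or_lt with rfl | hi
        · rw [decompose_of_mem_same 𝒜 (decompose 𝒜 s n).2, sub_self]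
        · rw [decompose_of_mem_ne 𝒜 (decompose 𝒜 s n).2 hi.ne, h i hi, sub_zero]) i
      rcases eq_or_ne n i with rfl | hi
      · exact hn
      · rwa [decompose_sub, DirectSum.sub_apply, AddSubgroupClass.coe_sub,
          decompose_of_mem_ne 𝒜 (decompose 𝒜 s n).2 hi, sub_zero] at h2
  intro i s hs
  obtain ⟨n, hn⟩ := decompose_eq_zero_of_lt_of_forall (𝒜 := 𝒜) s
  exact key n s hs hn i

theorem exists_mem_graded_notMem_of_not_le {P Q : Ideal R} (hQ : Q.IsHomogeneous 𝒜)
    (h : ¬ Q ≤ P) : ∃ i, ∃ x ∈ 𝒜 i, x ∈ Q ∧ x ∉ P := by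
  obtain ⟨x, hxQ, hxP⟩ := SetLike.not_le_iff_exists.1 h
  by_contra! H
  classical
  refine hxP ?_
  rw [← sum_support_decompose 𝒜 x]
  exact sum_mem fun i _ => H i _ (decompose 𝒜 x i).2 (hQ i hxQ)

theorem exists_mem_graded_pos_notMem {P : Ideal R}
    (h : ¬ (HomogeneousIdeal.irrelevant 𝒜).toIdeal ≤ P) : ∃ i, 0 < i ∧ ∃ x ∈ 𝒜 i, x ∉ P := by
  rw [HomogeneousIdeal.toIdeal_irrelevant_le] at h
  push Not at h
  obtain ⟨i, hi, h⟩ := h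
  obtain ⟨x, hx, hxP⟩ := SetLike.not_le_iff_exists.1 h
  exact ⟨i, hi, x, hx, hxP⟩

/-- Homogeneous prime avoidance for finitely many incomparable homogeneous primes. -/
theorem exists_mem_graded_pos_forall_notMem (S : Finset (Ideal R))
    (hprime : ∀ P ∈ S, P.IsPrime) (hhom : ∀ P ∈ S, P.IsHomogeneous 𝒜)
    (hle : ∀ P ∈ S, ∀ P' ∈ S, P ≤ P' → P = P')
    (hirr : ∀ P ∈ S, ¬ (HomogeneousIdeal.irrelevant 𝒜).toIdeal ≤ P) :
    ∃ i, 0 < i ∧ ∃ x ∈ 𝒜 i, ∀ P ∈ S, x ∉ P := by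
  classical
  induction S using Finset.induction_on with
  | empty => exact ⟨1, one_pos, 0, zero_mem _, by simp⟩
  | insert P S hPS ih =>
    obtain ⟨i, hi, y, hy, hyS⟩ := ih (fun Q hQ => hprime Q (Finset.mem_insert_of_mem hQ))
      (fun Q hQ => hhom Q (Finset.mem_insert_of_mem hQ))
      (fun Q hQ Q' hQ' => hle Q (Finset.mem_insert_of_mem hQ) Q' (Finset.mem_insert_of_mem hQ'))
      (fun Q hQ => hirr Q (Finset.mem_insert_of_mem hQ))
    by_cases hyP : y ∈ P
    swap
    · exact ⟨i, hi, y, hy, by simpa [Finset.forall_mem_insert] using ⟨hyP, hyS⟩⟩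
    have hP := hprime P (Finset.mem_insert_self P S)
    obtain ⟨j, hj, u, hu, huP⟩ :=
      exists_mem_graded_pos_notMem (hirr P (Finset.mem_insert_self P S))
    have hz : ∀ Q : S, ∃ i, ∃ x ∈ 𝒜 i, x ∈ Q.1 ∧ x ∉ P := fun Q =>
      exists_mem_graded_notMem_of_not_le (hhom Q (Finset.mem_insert_of_mem Q.2)) fun h => by
        have := hle Q (Finset.mem_insert_of_mem Q.2) P (Finset.mem_insert_self P S) h
        exact hPS (this ▸ Q.2)
    choose e z hze hzQ hzP using hz
    -- The product lies in every member of `S` but not in `P`. The factor `u` keeps its degree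
    -- positive even when `S` is empty or the `z Q` have degree zero.
    have hw : u * ∏ Q : S, z Q ∈ 𝒜 (j + ∑ Q : S, e Q) :=
      SetLike.mul_mem_graded hu (SetLike.prod_mem_graded 𝒜 e z fun Q _ => hze Q)
    have hwP : u * ∏ Q : S, z Q ∉ P := by
      rw [hP.mul_mem_iff_mem_or_mem, hP.prod_mem_iff]
      push Not
      exact ⟨huP, fun Q _ => hzP Q⟩
    have hwS : ∀ Q ∈ S, u * ∏ Q : S, z Q ∈ Q := fun Q hQ =>
      Q.mul_mem_left _ (Ideal.mem_of_dvd _ (Finset.dvd_prod_of_mem z (Finset.mem_univ ⟨Q, hQ⟩))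
        (hzQ ⟨Q, hQ⟩))
    set v := u * ∏ Q : S, z Q
    set d := j + ∑ Q : S, e Q
    have hd : 0 < d := by omega
    -- The exponents equalize the degrees of the two summands; each prime contains exactly one of
    -- them.
    refine ⟨d * i, by positivity, y ^ d + v ^ i, add_mem (SetLike.pow_mem_graded d hy) ?_, ?_⟩
    · rw [mul_comm]
      exact SetLike.pow_mem_graded i hw
    · rw [Finset.forall_mem_insert]
      constructor
      · rw [P.add_mem_iff_right (P.pow_mem_of_mem hyP d hd)]
        exact fun h => hwP (hP.mem_of_pow_mem i h)
      · intro Q hQ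
        rw [Q.add_mem_iff_left (Q.pow_mem_of_mem (hwS Q hQ) i hi)]
        exact fun h => hyS Q hQ ((hprime Q (Finset.mem_insert_of_mem hQ)).mem_of_pow_mem d h)

/-! ### Homogeneous generators, degree bounds and graded Nakayama. -/

theorem Ideal.isHomogeneous_span_range {κ : Type*} {h : κ → R} {d : κ → ℕ}
    (hd : ∀ i, h i ∈ 𝒜 (d i)) : (Ideal.span (Set.range h)).IsHomogeneous 𝒜 := by
  refine Ideal.homogeneous_span 𝒜 _ ?_
  rintro _ ⟨i, rfl⟩
  exact ⟨d i, hd i⟩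

/-- Take the component of degree `n - d i` of each coefficient. The explicit zero guards against
truncated subtraction when `d i` exceeds `n`. -/
theorem exists_eq_sum_of_mem_span_range {κ : Type*} [Fintype κ] {h : κ → R} {d : κ → ℕ}
    (hd : ∀ i, h i ∈ 𝒜 (d i)) {n : ℕ} {x : R} (hx : x ∈ 𝒜 n) (hxh : x ∈ Ideal.span (Set.range h)) :
    ∃ r : κ → R, (∀ i, d i ≤ n → r i ∈ 𝒜 (n - d i)) ∧ (∀ i, ¬ d i ≤ n → r i = 0) ∧
      x = ∑ i, h i * r i := by
  obtain ⟨c, rfl⟩ := (Submodule.mem_span_range_iff_exists_fun R).1 hxh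
  refine ⟨fun i => if d i ≤ n then (decompose 𝒜 (c i) (n - d i) : R) else 0, ?_, ?_, ?_⟩
  · intro i hi
    simp only [if_pos hi]
    exact SetLike.coe_mem _
  · intro i hi
    simp only [if_neg hi]
  · conv_lhs => rw [← decompose_of_mem_same 𝒜 hx]
    rw [decompose_sum, DFinsupp.finsetSum_apply, AddSubmonoidClass.coe_finsetSum]
    refine Finset.sum_congr rfl fun i _ => ?_
    rw [smul_eq_mul, mul_comm, coe_decompose_mul_of_left_mem 𝒜 n (hd i)]
    dsimp only
    rw [mul_ite, mul_zero]

/-- Modulo `J`, every element is a scalar, its degree-zero component, plus a nilpotent. -/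
theorem isIntegral_quotient_of_irrelevant_le_radical
    (h_zero : ∀ x ∈ 𝒜 0, ∃ a : k, algebraMap k R a = x) {J : Ideal R}
    (hJ : (HomogeneousIdeal.irrelevant 𝒜).toIdeal ≤ J.radical) : Algebra.IsIntegral k (R ⧸ J) := by
  refine ⟨fun x => ?_⟩
  obtain ⟨x, rfl⟩ := Ideal.Quotient.mk_surjective x
  obtain ⟨a, ha⟩ := h_zero _ (decompose 𝒜 x 0).2
  have h1 : x - algebraMap k R a ∈ J.radical := by
    refine hJ ?_
    rw [HomogeneousIdeal.mem_iff, HomogeneousIdeal.mem_irrelevant_iff, GradedRing.proj_apply,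
      decompose_sub, DirectSum.sub_apply, AddSubgroupClass.coe_sub, ha,
      decompose_of_mem_same 𝒜 (decompose 𝒜 x 0).2, sub_self]
  obtain ⟨t, ht⟩ := h1
  have h2 : IsIntegral k (Ideal.Quotient.mk J (x - algebraMap k R a)) := by
    refine IsIntegral.of_pow t.succ_pos ?_
    rw [← map_pow, Ideal.Quotient.eq_zero_iff_mem.2 (Ideal.mem_of_dvd _ (pow_dvd_pow _ t.le_succ) ht)]
    exact isIntegral_zero
  have h3 : IsIntegral k (algebraMap k (R ⧸ J) a) := isIntegral_algebraMap
  have h4 := h2.add h3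
  rwa [map_sub, show Ideal.Quotient.mk J (algebraMap k R a) = algebraMap k (R ⧸ J) a from rfl,
    sub_add_cancel] at h4

/-- Modulo a homogeneous ideal `J` containing a power of the irrelevant ideal, every homogeneous
element is a combination of finitely many elements, and vanishes in large degrees. -/
theorem exists_finset_forall_sub_mem [Algebra.FiniteType k R]
    (h_zero : ∀ x ∈ 𝒜 0, ∃ a : k, algebraMap k R a = x) {J : Ideal R} (hJh : J.IsHomogeneous 𝒜)
    (hJ : (HomogeneousIdeal.irrelevant 𝒜).toIdeal ≤ J.radical) :
    ∃ (U : Finset R) (n₀ : ℕ), (∀ n, n₀ ≤ n → ∀ x ∈ 𝒜 n, x ∈ J) ∧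
      ∀ n, ∀ x ∈ 𝒜 n, ∃ u ∈ Submodule.span k (U : Set R), u ∈ 𝒜 n ∧ x - u ∈ J := by
  classical
  have := isIntegral_quotient_of_irrelevant_le_radical h_zero hJ
  have hfin : Module.Finite k (R ⧸ J) := Algebra.IsIntegral.finite
  obtain ⟨V', hV'⟩ := hfin.fg_top
  obtain ⟨V, hV⟩ : ∃ V : Finset R, Ideal.Quotient.mk J '' V = V' :=
    ⟨V'.image Quotient.out, by simp [Set.image_image]⟩
  have hspan : ∀ x : R, ∃ v ∈ Submodule.span k (V : Set R), x - v ∈ J := by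
    intro x
    have hx : Ideal.Quotient.mkₐ k J x ∈
        Submodule.span k ((Ideal.Quotient.mkₐ k J).toLinearMap '' (V : Set R)) := by
      have : ((Ideal.Quotient.mkₐ k J).toLinearMap '' (V : Set R)) = (V' : Set (R ⧸ J)) := by
        rw [← hV]; rfl
      rw [this, hV']
      trivial
    rw [← Submodule.map_span] at hx
    obtain ⟨v, hv, hvx⟩ := hx
    exact ⟨v, hv, Ideal.Quotient.eq.1 hvx.symm⟩
  choose b hb using fun s : R => decompose_eq_zero_of_lt_of_forall (𝒜 := 𝒜) s
  set N := V.sup b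
  have hN : ∀ n, N ≤ n → ∀ v ∈ Submodule.span k (V : Set R), GradedAlgebra.proj 𝒜 n v = 0 := by
    intro n hn v hv
    have : Submodule.span k (V : Set R) ≤ LinearMap.ker (GradedAlgebra.proj 𝒜 n) := by
      rw [Submodule.span_le]
      intro v hv
      exact hb v n ((Finset.le_sup hv).trans hn)
    exact this hv
  -- The finite set consists of the homogeneous components, below `N`, of lifts of generators of `R
  -- ⧸ J` over `k`; from degree `N` on these components vanish.
  refine ⟨(Finset.range N).biUnion fun n => V.image (GradedAlgebra.proj 𝒜 n), N, ?_, ?_⟩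
  · intro n hn x hx
    obtain ⟨v, hv, hxv⟩ := hspan x
    have h1 := hJh n hxv
    have h2 : (decompose 𝒜 v n : R) = 0 := hN n hn v hv
    rwa [decompose_sub, DirectSum.sub_apply, AddSubgroupClass.coe_sub, h2, sub_zero,
      decompose_of_mem_same 𝒜 hx] at h1
  · intro n x hx
    obtain ⟨v, hv, hxv⟩ := hspan x
    refine ⟨decompose 𝒜 v n, ?_, SetLike.coe_mem _, ?_⟩
    · by_cases hn : N ≤ n
      · have h2 : (decompose 𝒜 v n : R) = 0 := hN n hn v hv
        rw [h2]
        exact zero_mem _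
      · have h1 := Submodule.mem_map_of_mem (f := GradedAlgebra.proj 𝒜 n) hv
        rw [Submodule.map_span] at h1
        refine Submodule.span_mono ?_ h1
        rw [Finset.coe_biUnion, ← Finset.coe_image]
        exact Set.subset_biUnion_of_mem
          (u := fun n => ((V.image (GradedAlgebra.proj 𝒜 n) : Finset R) : Set R))
          (by simpa using hn : n ∈ ((Finset.range N : Finset ℕ) : Set ℕ))
    · have h1 := hJh n hxv
      rwa [decompose_sub, DirectSum.sub_apply, AddSubgroupClass.coe_sub,
        decompose_of_mem_same 𝒜 hx] at h1

/-- If `𝔟` is generated by elements of degree `w` and contains a power of the irrelevant ideal,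
then `R_n ⊆ 𝔟 ^ j` as soon as `n` is at least `j w` plus a constant. -/
theorem exists_forall_mem_span_range_pow [Algebra.FiniteType k R]
    (h_zero : ∀ x ∈ 𝒜 0, ∃ a : k, algebraMap k R a = x) {κ : Type*} [Finite κ] {h : κ → R} {w : ℕ}
    (hw : ∀ i, h i ∈ 𝒜 w)
    (hJ : (HomogeneousIdeal.irrelevant 𝒜).toIdeal ≤ (Ideal.span (Set.range h)).radical) :
    ∃ n₀ : ℕ, ∀ j n, n₀ + j * w ≤ n → ∀ x ∈ 𝒜 n, x ∈ Ideal.span (Set.range h) ^ j := by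
  cases nonempty_fintype κ
  obtain ⟨-, n₀, hn₀, -⟩ :=
    exists_finset_forall_sub_mem h_zero (Ideal.isHomogeneous_span_range (d := fun _ => w) hw) hJ
  refine ⟨n₀, fun j => ?_⟩
  induction j with
  | zero => simp
  | succ j ih =>
    intro n hn x hx
    rw [add_one_mul] at hn
    obtain ⟨r, hr, -, rfl⟩ :=
      exists_eq_sum_of_mem_span_range (d := fun _ => w) hw hx (hn₀ n (by omega) x hx)
    rw [pow_succ']
    exact sum_mem fun i _ => Ideal.mul_mem_mul (Ideal.subset_span ⟨i, rfl⟩)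
      (ih (n - w) (by omega) _ (hr i (by omega)))

/-- Graded Nakayama: `R` is finite over any ring whose image contains `k` and homogeneous elements
of a positive degree `w` that generate an ideal containing a power of the irrelevant ideal. -/
theorem ringHom_finite_of_irrelevant_le_radical [Algebra.FiniteType k R]
    (h_zero : ∀ x ∈ 𝒜 0, ∃ a : k, algebraMap k R a = x) {κ : Type*} [Finite κ] {h : κ → R} {w : ℕ}
    (hw0 : 0 < w) (hw : ∀ i, h i ∈ 𝒜 w)
    (hJ : (HomogeneousIdeal.irrelevant 𝒜).toIdeal ≤ (Ideal.span (Set.range h)).radical)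
    {A : Type*} [CommRing A] (φ : A →+* R) (hk : ∀ c : k, ∃ a, φ a = algebraMap k R c)
    (hh : ∀ i, ∃ a, φ a = h i) : φ.Finite := by
  cases nonempty_fintype κ
  classical
  obtain ⟨U, -, -, hU⟩ :=
    exists_finset_forall_sub_mem h_zero (Ideal.isHomogeneous_span_range (d := fun _ => w) hw) hJ
  algebraize [φ]
  change Module.Finite A R
  have hφ : ∀ a (x : R), a • x = φ a * x := fun a x => Algebra.smul_def a x
  have hUA : ∀ u ∈ Submodule.span k (U : Set R), u ∈ Submodule.span A (U : Set R) := by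
    intro u hu
    induction hu using Submodule.span_induction with
    | mem u hu => exact Submodule.subset_span hu
    | zero => exact zero_mem _
    | add u v _ _ hu hv => exact add_mem hu hv
    | smul c u _ hu =>
      obtain ⟨a, ha⟩ := hk c
      rw [Algebra.smul_def, ← ha, ← hφ]
      exact Submodule.smul_mem _ a hu
  -- Modulo the span of `U`, an element of degree `n` is a combination of the `h i` with
  -- coefficients of degree `n - w`, which is smaller as `w` is positive.
  have key : ∀ n, ∀ x ∈ 𝒜 n, x ∈ Submodule.span A (U : Set R) := by
    intro n
    induction n using Nat.strong_induction_on with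
    | _ n ih =>
      intro x hx
      obtain ⟨u, hu, hun, hxu⟩ := hU n x hx
      rw [← sub_add_cancel x u]
      refine add_mem ?_ (hUA u hu)
      obtain ⟨r, hr, hr0, h1⟩ :=
        exists_eq_sum_of_mem_span_range (d := fun _ => w) hw (sub_mem hx hun) hxu
      rw [h1]
      refine sum_mem fun i _ => ?_
      obtain ⟨a, ha⟩ := hh i
      rw [← ha, ← hφ]
      refine Submodule.smul_mem _ a ?_
      by_cases hn : w ≤ n
      · exact ih (n - w) (by omega) _ (hr i hn)
      · rw [hr0 i hn]
        exact zero_mem _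
  refine ⟨⟨U, ?_⟩⟩
  rw [eq_top_iff]
  intro x _
  rw [← sum_support_decompose 𝒜 x]
  exact sum_mem fun i _ => key i _ (SetLike.coe_mem _)

end Graded

/-! ### Linear degree bound for the `y`-power torsion. -/

/-- Pigeonhole, one generator at a time. The extra `1` makes the empty family work, where the zeroth
power of the zero ideal would be the unit ideal. -/
theorem Ideal.span_range_pow_card_mul_add_one_le {R ι : Type*} [CommRing R] [Fintype ι]
    (g : ι → R) (q : ℕ) :
    Ideal.span (Set.range g) ^ (Fintype.card ι * q + 1) ≤
      Ideal.span (Set.range fun i => g i ^ q) := by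
  classical
  have key : ∀ s : Finset ι, (s.sup fun i => Ideal.span {g i}) ^ (s.card * q + 1) ≤
      s.sup fun i => Ideal.span {g i ^ q} := by
    intro s
    induction s using Finset.induction_on with
    | empty => simp
    | insert i s hi ih =>
      rw [Finset.sup_insert, Finset.sup_insert, Finset.card_insert_of_notMem hi,
        show (s.card + 1) * q + 1 = q + (s.card * q + 1) by ring, ← Ideal.span_singleton_pow]
      exact Ideal.sup_pow_add_le_pow_sup_pow.trans (sup_le_sup le_rfl ih)
  have hs : ∀ h : ι → R, (Finset.univ.sup fun i => Ideal.span {h i}) =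
      Ideal.span (Set.range h) := fun h => by
    rw [Finset.sup_univ_eq_iSup, Ideal.span_range_eq_iSup]
  have := key Finset.univ
  rwa [hs, hs, Finset.card_univ] at this

theorem Ideal.span_range_option_elim {R ι : Type*} [CommRing R] (g : ι → R) (y : R) :
    Ideal.span (Set.range fun o : Option ι => o.elim y g) =
      Ideal.span (Set.range g) ⊔ Ideal.span {y} := by
  rw [Ideal.span_range_eq_iSup, iSup_option, Ideal.span_range_eq_iSup, sup_comm]
  rfl

section Graded

open DirectSum

variable {k R : Type*} [Field k] [CommRing R] [Algebra k R] {𝒜 : ℕ → Submodule k R}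
  [GradedAlgebra 𝒜]

/-- The case of generators of equal degrees of `exists_forall_mem_span_range_pow_of_pow_mul_mem`. -/
theorem exists_forall_mem_span_range_pow_of_pow_mul_mem_of_degree_eq [Algebra.FiniteType k R]
    (h_zero : ∀ x ∈ 𝒜 0, ∃ a : k, algebraMap k R a = x) {ι : Type*} [Fintype ι] {g : ι → R}
    {y : R} {w : ℕ} (hw0 : 0 < w) (hg : ∀ i, g i ∈ 𝒜 w) (hy : y ∈ 𝒜 w)
    (hJ : (HomogeneousIdeal.irrelevant 𝒜).toIdeal ≤
      (Ideal.span (Set.range g) ⊔ Ideal.span {y}).radical) :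
    ∃ c : ℕ, ∀ q N D x, 0 < q → c * q ≤ D → x ∈ 𝒜 D →
      y ^ N * x ∈ Ideal.span (Set.range fun i => g i ^ q) →
      x ∈ Ideal.span (Set.range fun i => g i ^ q) := by
  have hw : ∀ o : Option ι, o.elim y g ∈ 𝒜 w := by rintro (_ | i); exacts [hy, hg i]
  rw [← Ideal.span_range_option_elim] at hJ
  obtain ⟨n₀, hn₀⟩ := exists_forall_mem_span_range_pow h_zero hw hJ
  set φ₀ : MvPolynomial ι k →+* R := (MvPolynomial.aeval g : MvPolynomial ι k →ₐ[k] R).toRingHom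
  have hφX : ∀ i, φ₀ (MvPolynomial.X i) = g i := fun i => MvPolynomial.aeval_X g i
  set φ := Polynomial.eval₂RingHom φ₀ y
  have hφy : φ Polynomial.X = y := Polynomial.eval₂_X _ _
  have hφC : φ.comp Polynomial.C = φ₀ := RingHom.ext fun b => Polynomial.eval₂_C _ _
  have hφCa : ∀ b, φ (Polynomial.C b) = φ₀ b := fun b => Polynomial.eval₂_C _ _
  have hφ : φ.Finite := by
    refine ringHom_finite_of_irrelevant_le_radical h_zero hw0 hw hJ φ (fun c =>
      ⟨Polynomial.C (MvPolynomial.C c), ?_⟩) ?_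
    · rw [hφCa]
      exact MvPolynomial.aeval_C g c
    · rintro (_ | i)
      · exact ⟨Polynomial.X, hφy⟩
      · exact ⟨Polynomial.C (MvPolynomial.X i), by rw [hφCa, hφX]; rfl⟩
  obtain ⟨k₀, hk₀⟩ := Polynomial.exists_forall_mem_map_of_X_pow_mul_mem φ hφ
    (Ideal.span (Set.range (MvPolynomial.X : ι → MvPolynomial ι k)))
  have hmapg : (Ideal.span (Set.range (MvPolynomial.X : ι → MvPolynomial ι k))).map φ₀ =
      Ideal.span (Set.range g) := by
    rw [Ideal.map_span, ← Set.range_comp]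
    congr 2
    exact funext hφX
  have hmapJ : ∀ q, (Ideal.span (Set.range fun i => (MvPolynomial.X i : MvPolynomial ι k) ^ q)).map
      φ₀ = Ideal.span (Set.range fun i => g i ^ q) := by
    intro q
    rw [Ideal.map_span, ← Set.range_comp]
    congr 2
    exact funext fun i => by rw [Function.comp_apply, map_pow, hφX]
  rw [hφC, hφy, hmapg, ← Ideal.span_range_option_elim] at hk₀
  -- The constant is chosen so that `c * q` is at least `n₀ + j * w` with `j = k₀ + t + q`;
  -- positivity of `q` absorbs the constant terms.
  refine ⟨n₀ + (k₀ + Fintype.card ι + 2) * w, fun q N D x hq hD hx hyx => ?_⟩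
  set t := Fintype.card ι * q + 1 with ht
  set j := k₀ + t + q with hj
  have hDj : n₀ + j * w ≤ D := by
    refine le_trans ?_ hD
    have h1 : j ≤ (k₀ + Fintype.card ι + 2) * q := by
      rw [hj, ht]
      nlinarith
    nlinarith [Nat.mul_le_mul_right w h1]
  have hl : j + N = (k₀ + t + N) + q := by omega
  have hlw : j * w + N * w = (k₀ + t + N) * w + q * w := by rw [← add_mul, hl, add_mul]
  have h := hk₀ (Ideal.span (Set.range fun i => (MvPolynomial.X i : MvPolynomial ι k) ^ q)) q t N j
    (k₀ + t + N) ?_ (Ideal.span_range_pow_card_mul_add_one_le _ q) (by omega) hl.le x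
    (hn₀ j D hDj x hx)
  · rw [hmapJ] at h
    refine h ?_
    -- Homogeneous coefficients have degree `N w + D - q w`, which is large enough to put them in
    -- the power `k₀ + t + N` of the ideal `(g, y)`.
    obtain ⟨r, hr, -, hr'⟩ := exists_eq_sum_of_mem_span_range (d := fun _ => q * w)
      (fun i => SetLike.pow_mem_graded q (hg i))
      (SetLike.mul_mem_graded (SetLike.pow_mem_graded N hy) hx) hyx
    rw [hr']
    refine sum_mem fun i _ => Ideal.mul_mem_mul (Ideal.subset_span ⟨i, rfl⟩) ?_
    have hq' : q * w ≤ N • w + D := by rw [smul_eq_mul]; omega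
    refine hn₀ _ _ ?_ _ (hr i hq')
    rw [smul_eq_mul]
    omega
  · rw [Ideal.span_le]
    rintro _ ⟨i, rfl⟩
    exact Ideal.pow_mem_pow (Ideal.subset_span (Set.mem_range_self i)) q

/-- Let `f` be finitely many homogeneous elements of positive degree and `y` a homogeneous element
such that `(f, y)` contains a power of the irrelevant ideal. Then the `y`-power torsion of
`R / (f_i ^ q)` vanishes in degrees that are at least a constant times `q`. -/
theorem exists_forall_mem_span_range_pow_of_pow_mul_mem [Algebra.FiniteType k R]
    (h_zero : ∀ x ∈ 𝒜 0, ∃ a : k, algebraMap k R a = x) {ι : Type*} [Fintype ι] {f : ι → R}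
    {d : ι → ℕ} {y : R} {a : ℕ} (hd0 : ∀ i, 0 < d i) (hf : ∀ i, f i ∈ 𝒜 (d i)) (ha0 : 0 < a)
    (hy : y ∈ 𝒜 a)
    (hJ : (HomogeneousIdeal.irrelevant 𝒜).toIdeal ≤
      (Ideal.span (Set.range f) ⊔ Ideal.span {y}).radical) :
    ∃ c : ℕ, ∀ q N D x, 0 < q → c * q ≤ D → x ∈ 𝒜 D →
      y ^ N * x ∈ Ideal.span (Set.range fun i => f i ^ q) →
      x ∈ Ideal.span (Set.range fun i => f i ^ q) := by
  -- A common multiple of all degrees: suitable powers of the `f i` and of `y` then share the degree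
  -- `w`.
  set w := a * ∏ i, d i with hw
  have hw0 : 0 < w := Nat.mul_pos ha0 (Finset.prod_pos fun i _ => hd0 i)
  have hdw : ∀ i, d i ∣ w := fun i => (Finset.dvd_prod_of_mem d (Finset.mem_univ i)).mul_left a
  have haw : a ∣ w := dvd_mul_right _ _
  set g : ι → R := fun i => f i ^ (w / d i) with hgdef
  set Y := y ^ (w / a) with hYdef
  have hg : ∀ i, g i ∈ 𝒜 w := fun i => by
    have := SetLike.pow_mem_graded (w / d i) (hf i)
    rwa [smul_eq_mul, Nat.div_mul_cancel (hdw i)] at this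
  have hY : Y ∈ 𝒜 w := by
    have := SetLike.pow_mem_graded (w / a) hy
    rwa [smul_eq_mul, Nat.div_mul_cancel haw] at this
  have hJ' : (HomogeneousIdeal.irrelevant 𝒜).toIdeal ≤
      (Ideal.span (Set.range g) ⊔ Ideal.span {Y}).radical := by
    refine hJ.trans (Ideal.radical_le_radical_iff.2 (sup_le (Ideal.span_le.2 ?_) ?_))
    · rintro _ ⟨i, rfl⟩
      exact ⟨w / d i, Ideal.mem_sup_left (Ideal.subset_span ⟨i, rfl⟩)⟩
    · rw [Ideal.span_singleton_le_iff_mem]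
      exact ⟨w / a, Ideal.mem_sup_right (Ideal.mem_span_singleton_self Y)⟩
  obtain ⟨c, hc⟩ :=
    exists_forall_mem_span_range_pow_of_pow_mul_mem_of_degree_eq h_zero hw0 hg hY hJ'
  have hh : ∀ o : Option ι, o.elim Y g ∈ 𝒜 w := by rintro (_ | i); exacts [hY, hg i]
  rw [← Ideal.span_range_option_elim] at hJ'
  obtain ⟨n₀, hn₀⟩ := exists_forall_mem_span_range_pow h_zero hh hJ'
  rw [Ideal.span_range_option_elim] at hn₀
  refine ⟨c + n₀ + (Fintype.card ι + 2) * w, fun q N D x hq hD hx hyx => ?_⟩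
  have hgf : Ideal.span (Set.range fun i => g i ^ q) ≤ Ideal.span (Set.range fun i => f i ^ q) := by
    rw [Ideal.span_le]
    rintro _ ⟨i, rfl⟩
    have hne : w / d i ≠ 0 := (Nat.div_pos (Nat.le_of_dvd hw0 (hdw i)) (hd0 i)).ne'
    simp only [hgdef]
    rw [← pow_mul, mul_comm, pow_mul]
    exact Ideal.pow_mem_of_mem _ (Ideal.subset_span (Set.mem_range_self i)) _
      (Nat.pos_of_ne_zero hne)
  have hYx : Y ^ N * x ∈ Ideal.span (Set.range fun i => f i ^ q) := by
    have h1 : N ≤ w / a * N := Nat.le_mul_of_pos_left N (Nat.div_pos (Nat.le_of_dvd hw0 haw) ha0)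
    rw [hYdef, ← pow_mul, ← Nat.sub_add_cancel h1, pow_add, mul_assoc]
    exact Ideal.mul_mem_left _ _ hyx
  obtain ⟨r, hr, -, hrx⟩ := exists_eq_sum_of_mem_span_range (d := fun i => q * d i)
    (fun i => SetLike.pow_mem_graded q (hf i))
    (SetLike.mul_mem_graded (SetLike.pow_mem_graded N hY) hx) hYx
  -- The coefficients have degree high enough to lie in `(g, Y)^(card * q + 1 + N)`, hence in
  -- `(g_i^q) + (Y^N)`.
  have hr1 : ∀ i, ∃ r' s, s ∈ Ideal.span (Set.range fun i => g i ^ q) ∧ r i = Y ^ N * r' + s := by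
    intro i
    have h1 : d i ≤ w := Nat.le_of_dvd hw0 (hdw i)
    have h2 : q * d i ≤ q * w := Nat.mul_le_mul_left q h1
    have h3 : n₀ + (Fintype.card ι * q + 1) * w + q * w ≤ D := by nlinarith
    have h4 : r i ∈ (Ideal.span (Set.range g) ⊔ Ideal.span {Y}) ^
        (Fintype.card ι * q + 1 + N) := by
      refine hn₀ _ _ ?_ _ (hr i ?_)
      · rw [smul_eq_mul, add_mul]
        omega
      · rw [smul_eq_mul]
        omega
    have h5 := (Ideal.sup_pow_add_le_pow_sup_pow.trans
      (sup_le_sup (Ideal.span_range_pow_card_mul_add_one_le g q) le_rfl)) h4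
    rw [Ideal.span_singleton_pow] at h5
    obtain ⟨s, hs, u, hu, hsu⟩ := Submodule.mem_sup.1 h5
    obtain ⟨r', rfl⟩ := Ideal.mem_span_singleton'.1 hu
    exact ⟨r', s, hs, by rw [← hsu]; ring⟩
  choose r' s hs hr's using hr1
  -- Subtracting `v`, which is in `(f_i^q)`, moves the torsion relation from `(f_i^q)` to the
  -- smaller ideal `(g_i^q)`, where the equal-degree case applies.
  set v := ∑ i, f i ^ q * r' i with hv
  have hvf : v ∈ Ideal.span (Set.range fun i => f i ^ q) :=
    sum_mem fun i _ => Ideal.mul_mem_right _ _ (Ideal.subset_span ⟨i, rfl⟩)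
  have hYv : Y ^ N * (x - v) ∈ Ideal.span (Set.range fun i => g i ^ q) := by
    have h1 : Y ^ N * (x - v) = ∑ i, f i ^ q * s i := by
      rw [mul_sub, hrx, hv, Finset.mul_sum, ← Finset.sum_sub_distrib]
      exact Finset.sum_congr rfl fun i _ => by rw [hr's i]; ring
    rw [h1]
    exact sum_mem fun i _ => Ideal.mul_mem_left _ _ (hs i)
  -- `v` need not be homogeneous, so the relation is cut down to the component of `x - v` in degree
  -- `D`.
  have hYx' : Y ^ N * (decompose 𝒜 (x - v) D : R) ∈
      Ideal.span (Set.range fun i => g i ^ q) := by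
    have h1 := Ideal.isHomogeneous_span_range
      (fun i => SetLike.pow_mem_graded q (hg i)) (N • w + D) hYv
    rwa [coe_decompose_mul_add_of_left_mem 𝒜 (SetLike.pow_mem_graded N hY)] at h1
  have hcD : c * q ≤ D := (Nat.mul_le_mul_right q
    ((Nat.le_add_right c n₀).trans (Nat.le_add_right _ _))).trans hD
  have h1 := hgf (hc q N D _ hq hcD (SetLike.coe_mem _) hYx')
  have h2 := Ideal.isHomogeneous_span_range
      (fun i => SetLike.pow_mem_graded q (hf i)) D hvf
  rw [decompose_sub, DirectSum.sub_apply, AddSubgroupClass.coe_sub,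
    decompose_of_mem_same 𝒜 hx] at h1
  simpa using add_mem h1 h2

end Graded

/-! ### Components at minimal primes and the coheight-one condition. -/

theorem frobeniusPower_le_iff {R : Type*} [CommRing R] {I J : Ideal R} {n : ℕ} :
    frobeniusPower I n ≤ J ↔ ∀ x ∈ I, x ^ n ∈ J := by
  rw [frobeniusPower, Ideal.span_le, Set.image_subset_iff]
  rfl

theorem pow_mem_frobeniusPower {R : Type*} [CommRing R] {I : Ideal R} (n : ℕ) {x : R} (hx : x ∈ I) :
    x ^ n ∈ frobeniusPower I n :=
  frobeniusPower_le_iff.1 le_rfl x hx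

theorem minimalPrimes_frobeniusPower {R : Type*} [CommRing R] (I : Ideal R) {n : ℕ} (hn : 0 < n) :
    (frobeniusPower I n).minimalPrimes = I.minimalPrimes := by
  have : (frobeniusPower I n).radical = I.radical := by
    refine le_antisymm (Ideal.radical_mono (frobeniusPower_le_iff.2 fun x hx =>
      I.pow_mem_of_mem hx n hn)) (Ideal.radical_le_radical_iff.2 fun x hx => ?_)
    exact ⟨n, pow_mem_frobeniusPower n hx⟩
  rw [← Ideal.radical_minimalPrimes, this, Ideal.radical_minimalPrimes]

theorem Ideal.radical_comap_map_atPrime {R : Type*} [CommRing R] {J P : Ideal R} [P.IsPrime]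
    (hP : P ∈ J.minimalPrimes) :
    ((J.map (algebraMap R (Localization.AtPrime P))).comap
      (algebraMap R (Localization.AtPrime P))).radical = P := by
  rw [← Ideal.comap_radical, IsLocalization.AtPrime.radical_map_of_mem_minimalPrimes _ P J hP,
    IsLocalization.AtPrime.map_eq_maximalIdeal P (Localization.AtPrime P)]
  exact IsLocalization.AtPrime.under_maximalIdeal (Localization.AtPrime P) P

theorem Ideal.isPrimary_comap_map_atPrime {R : Type*} [CommRing R] {J P : Ideal R} [P.IsPrime]
    (hP : P ∈ J.minimalPrimes) :
    ((J.map (algebraMap R (Localization.AtPrime P))).comap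
      (algebraMap R (Localization.AtPrime P))).IsPrimary := by
  refine Ideal.IsPrimary.comap (Ideal.isPrimary_of_isMaximal_radical ?_) _
  rw [IsLocalization.AtPrime.radical_map_of_mem_minimalPrimes _ P J hP,
    IsLocalization.AtPrime.map_eq_maximalIdeal P (Localization.AtPrime P)]
  infer_instance

theorem Ideal.mem_comap_map_atPrime_iff {R : Type*} [CommRing R] {J P : Ideal R} [P.IsPrime]
    {x : R} : x ∈ (J.map (algebraMap R (Localization.AtPrime P))).comap
      (algebraMap R (Localization.AtPrime P)) ↔ ∃ s ∉ P, s * x ∈ J := by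
  rw [Ideal.mem_comap, IsLocalization.algebraMap_mem_map_algebraMap_iff P.primeCompl]
  rfl

/-- Linear growth for the primary components at minimal primes. -/
theorem exists_frobeniusPower_pow_le_comap_map_atPrime {R : Type*} [CommRing R] [IsNoetherianRing R]
    {I P : Ideal R} [P.IsPrime] (hP : P ∈ I.minimalPrimes) :
    ∃ c : ℕ, ∀ c' n, c ≤ c' → frobeniusPower (P ^ c') n ≤
      ((frobeniusPower I n).map (algebraMap R (Localization.AtPrime P))).comap
        (algebraMap R (Localization.AtPrime P)) := by
  obtain ⟨c, hc⟩ := Ideal.exists_radical_pow_le_of_fg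
    ((I.map (algebraMap R (Localization.AtPrime P))).comap (algebraMap R (Localization.AtPrime P)))
    (IsNoetherian.noetherian _)
  rw [Ideal.radical_comap_map_atPrime hP] at hc
  refine ⟨c, fun c' n hcc' => frobeniusPower_le_iff.2 fun x hx => ?_⟩
  obtain ⟨s, hs, hsx⟩ := Ideal.mem_comap_map_atPrime_iff.1 (hc (Ideal.pow_le_pow_right hcc' hx))
  -- The multiplier for `x` modulo `I`, raised to the power `n`, works for `x^n`; hence the exponent
  -- `c` found for `I` itself serves all `n`.
  refine Ideal.mem_comap_map_atPrime_iff.2 ⟨s ^ n, ?_, ?_⟩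
  · exact fun h => hs (Ideal.IsPrime.mem_of_pow_mem ‹_› n h)
  · rw [← mul_pow]
    exact pow_mem_frobeniusPower n hsx

/-- A further strict inclusion would give `M` height at least `I.height + 2`, exceeding the
dimension; `I.height` is finite since `I` is proper in a Noetherian ring. -/
theorem Ideal.eq_of_height_add_one_eq_ringKrullDim {R : Type*} [CommRing R] [IsNoetherianRing R]
    {I P Q M : Ideal R} [P.IsPrime] [Q.IsPrime] [M.IsPrime]
    (h : (I.height : WithBot ℕ∞) + 1 = ringKrullDim R) (hIP : I ≤ P) (hPQ : P < Q) (hQM : Q ≤ M) :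
    Q = M := by
  by_contra hne
  have h1 := Ideal.height_add_one_le_of_lt_of_isPrime hPQ
  have h2 := Ideal.height_add_one_le_of_lt_of_isPrime (lt_of_le_of_ne hQM hne)
  have h3 : (M.height : WithBot ℕ∞) ≤ ringKrullDim R := Ideal.height_le_ringKrullDim_of_isPrime
  rw [← h] at h3
  have h4 : M.height ≤ I.height + 1 := by exact_mod_cast h3
  have h5 := Ideal.height_mono hIP
  have h6 : I.height ≠ ⊤ := Ideal.height_ne_top fun hI => by
    rw [hI, top_le_iff] at hIP
    exact Ideal.IsPrime.ne_top ‹_› hIP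
  have h7 : I.height + 1 + 1 ≤ I.height + 1 :=
    (add_le_add_left ((add_le_add_left h5 1).trans h1) 1).trans (h2.trans h4)
  exact absurd (ENat.add_one_le_iff (by simpa using h6) |>.1 h7) (lt_irrefl _)

theorem HasLinearGrowthOfPrimaryDecompositions.of_finite {R : Type*} [CommRing R] {p : ℕ}
    {I : Ideal R} {ι : Type*} [Finite ι] (c : ℕ) (Q : ℕ → ι → Ideal R)
    (hQ : ∀ e i, (Q e i).IsPrimary) (hI : ∀ e, frobeniusPower I (p ^ e) = ⨅ i, Q e i)
    (hc : ∀ e i, frobeniusPower ((Q e i).radical ^ c) (p ^ e) ≤ Q e i) :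
    HasLinearGrowthOfPrimaryDecompositions p I := by
  obtain ⟨r, ⟨f⟩⟩ := Finite.exists_equiv_fin ι
  refine ⟨c, fun e => ⟨r, fun i => Q e (f.symm i), fun i => hQ e _, ?_, fun i => hc e _⟩⟩
  rw [hI e, f.symm.iInf_comp]

/-! ### Parameters and saturation for homogeneous ideals. -/

section Graded

open DirectSum

variable {k R : Type*} [Field k] [CommRing R] [Algebra k R] {𝒜 : ℕ → Submodule k R}
  [GradedAlgebra 𝒜]

/-- A proper finitely generated homogeneous ideal is generated by finitely many homogeneous elements
of positive degree. -/
theorem Ideal.IsHomogeneous.exists_eq_span_range [IsNoetherianRing R]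
    (h_zero : ∀ x ∈ 𝒜 0, ∃ a : k, algebraMap k R a = x) {I : Ideal R} (hI : I.IsHomogeneous 𝒜)
    (hIt : I ≠ ⊤) : ∃ (n : ℕ) (f : Fin n → R) (d : Fin n → ℕ), (∀ i, 0 < d i) ∧
      (∀ i, f i ∈ 𝒜 (d i)) ∧ I = Ideal.span (Set.range f) := by
  have hcore : Ideal.span {x | SetLike.IsHomogeneousElem 𝒜 x ∧ x ∈ I} = I := by
    refine le_antisymm (Ideal.span_le.2 fun x hx => hx.2) fun x hx => ?_
    classical
    rw [← sum_support_decompose 𝒜 x]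
    refine Ideal.sum_mem _ fun i _ => Ideal.subset_span ?_
    exact ⟨⟨i, SetLike.coe_mem _⟩, hI i hx⟩
  obtain ⟨T, hT, hspan⟩ := (Submodule.fg_span_iff_fg_span_finset_subset _).1
    (IsNoetherian.noetherian (Ideal.span {x | SetLike.IsHomogeneousElem 𝒜 x ∧ x ∈ I}))
  have hpos : ∀ x : T, ∃ d, 0 < d ∧ x.1 ∈ 𝒜 d := by
    rintro ⟨x, hx⟩
    obtain ⟨⟨d, hd⟩, hxI⟩ := hT hx
    rcases Nat.eq_zero_or_pos d with rfl | hd0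
    · refine ⟨1, one_pos, ?_⟩
      have h := hI.le_irrelevant h_zero hIt hxI
      rw [HomogeneousIdeal.mem_iff, HomogeneousIdeal.mem_irrelevant_iff, GradedRing.proj_apply,
        decompose_of_mem_same 𝒜 hd] at h
      change x ∈ _
      rw [h]
      exact zero_mem _
    · exact ⟨d, hd0, hd⟩
  choose d hd0 hd using hpos
  refine ⟨_, fun i => (T.equivFin.symm i).1, fun i => d (T.equivFin.symm i), fun i => hd0 _,
    fun i => hd _, ?_⟩
  rw [← hcore, Ideal.span, hspan]
  congr 1
  ext x
  constructor
  · intro hx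
    exact ⟨T.equivFin ⟨x, hx⟩, by simp⟩
  · rintro ⟨i, rfl⟩
    exact (T.equivFin.symm i).2

theorem decompose_eq_zero_of_mem_irrelevant_pow {t n : ℕ} (hn : n < t) {x : R}
    (hx : x ∈ (HomogeneousIdeal.irrelevant 𝒜).toIdeal ^ t) : (decompose 𝒜 x n : R) = 0 := by
  induction t generalizing n x with
  | zero => omega
  | succ t ih =>
    rw [pow_succ'] at hx
    induction hx using Submodule.mul_induction_on' with
    | mem_mul_mem a ha b hb =>
      rw [decompose_mul, coe_mul_apply_eq_sum_antidiagonal]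
      refine Finset.sum_eq_zero ?_
      rintro ⟨i, j⟩ hij
      rw [Finset.HasAntidiagonal.mem_antidiagonal] at hij
      simp only at hij ⊢
      rcases Nat.eq_zero_or_pos i with rfl | hi
      · rw [HomogeneousIdeal.mem_iff, HomogeneousIdeal.mem_irrelevant_iff,
          GradedRing.proj_apply] at ha
        rw [ha, zero_mul]
      · rw [ih (by omega) hb, mul_zero]
    | add a _ b _ ha hb =>
      rw [decompose_add, DirectSum.add_apply, Submodule.coe_add, ha, hb, add_zero]

/-- The saturation of a homogeneous ideal by a homogeneous element is homogeneous. -/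
theorem Ideal.IsHomogeneous.comap_map_away {J : Ideal R} (hJ : J.IsHomogeneous 𝒜) {a : ℕ} {y : R}
    (hy : y ∈ 𝒜 a) : ((J.map (algebraMap R (Localization.Away y))).comap
      (algebraMap R (Localization.Away y))).IsHomogeneous 𝒜 := by
  intro i x hx
  rw [Ideal.mem_comap, IsLocalization.algebraMap_mem_map_algebraMap_iff (Submonoid.powers y)] at *
  obtain ⟨_, ⟨N, rfl⟩, hN⟩ := hx
  refine ⟨_, ⟨N, rfl⟩, ?_⟩
  have := hJ (N • a + i) hN
  rwa [coe_decompose_mul_add_of_left_mem 𝒜 (SetLike.pow_mem_graded N hy)] at this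

/-- A homogeneous ideal of coheight one admits a homogeneous element of positive degree avoiding
the non-irrelevant minimal primes; it is a parameter modulo the ideal. -/
theorem exists_parameter_of_height_add_one_eq [IsNoetherianRing R] [Nontrivial R]
    (h_zero : ∀ x ∈ 𝒜 0, ∃ a : k, algebraMap k R a = x) {I : Ideal R} (hI : I.IsHomogeneous 𝒜)
    (h_height : (I.height : WithBot ℕ∞) + 1 = ringKrullDim R) :
    ∃ a, 0 < a ∧ ∃ y ∈ 𝒜 a,
      (HomogeneousIdeal.irrelevant 𝒜).toIdeal ≤ (I ⊔ Ideal.span {y}).radical := by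
  have hm := irrelevant_isMaximal (𝒜 := 𝒜) h_zero
  have hfin := I.finite_minimalPrimes_of_isNoetherianRing
  classical
  obtain ⟨a, ha, y, hy, hyP⟩ := exists_mem_graded_pos_forall_notMem (𝒜 := 𝒜)
    (hfin.toFinset.filter fun P => ¬ (HomogeneousIdeal.irrelevant 𝒜).toIdeal ≤ P)
    (fun P hP => (hfin.mem_toFinset.1 (Finset.mem_filter.1 hP).1).1.1)
    (fun P hP => hI.of_mem_minimalPrimes (hfin.mem_toFinset.1 (Finset.mem_filter.1 hP).1))
    (fun P hP P' hP' hle => le_antisymm hle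
      ((hfin.mem_toFinset.1 (Finset.mem_filter.1 hP').1).2
        (hfin.mem_toFinset.1 (Finset.mem_filter.1 hP).1).1 hle))
    (fun P hP => (Finset.mem_filter.1 hP).2)
  refine ⟨a, ha, y, hy, ?_⟩
  rw [← Ideal.sInf_minimalPrimes]
  refine le_sInf fun Q hQ => ?_
  have hQp : Q.IsPrime := hQ.1.1
  have hyh : (Ideal.span {y}).IsHomogeneous 𝒜 := Ideal.homogeneous_span 𝒜 _ (by
    rintro _ rfl
    exact ⟨a, hy⟩)
  have hQh := (hI.sup hyh).of_mem_minimalPrimes hQ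
  obtain ⟨P, hP, hPQ⟩ := Ideal.exists_minimalPrimes_le (le_sup_left.trans hQ.1.2)
  have hPp : P.IsPrime := hP.1.1
  by_cases hmP : (HomogeneousIdeal.irrelevant 𝒜).toIdeal ≤ P
  · exact hmP.trans hPQ
  · have hyP' := hyP P (Finset.mem_filter.2 ⟨hfin.mem_toFinset.2 hP, hmP⟩)
    have hyQ : y ∈ Q := hQ.1.2 (Ideal.mem_sup_right (Ideal.mem_span_singleton_self y))
    have hlt : P < Q := lt_of_le_of_ne hPQ fun h => hyP' (h ▸ hyQ)
    have := hm.isPrime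
    exact (Ideal.eq_of_height_add_one_eq_ringKrullDim h_height hP.1.2 hlt
      (hQh.le_irrelevant h_zero hQp.ne_top)).ge

/-- Let `J` be a homogeneous ideal whose only homogeneous primes strictly above a minimal
prime are irrelevant. The intersection of the components of `J` at its minimal primes
other than the irrelevant ideal is contained in the saturation of `J` by any homogeneous element
of positive degree. -/
theorem mem_comap_map_away_of_forall_minimalPrimes [IsNoetherianRing R]
    {J : Ideal R} (hJ : J.IsHomogeneous 𝒜)
    (hdim : ∀ P ∈ J.minimalPrimes, ∀ Q : Ideal R, Q.IsPrime → Q.IsHomogeneous 𝒜 → P < Q →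
      Q = (HomogeneousIdeal.irrelevant 𝒜).toIdeal)
    {a : ℕ} (ha : 0 < a) {y : R} (hy : y ∈ 𝒜 a) {x : R}
    (hx : ∀ P ∈ J.minimalPrimes, P ≠ (HomogeneousIdeal.irrelevant 𝒜).toIdeal →
      ∃ s ∉ P, s * x ∈ J) :
    x ∈ (J.map (algebraMap R (Localization.Away y))).comap
      (algebraMap R (Localization.Away y)) := by
  have hTh := hJ.comap_map_away hy
  set T := (J.map (algebraMap R (Localization.Away y))).comap
    (algebraMap R (Localization.Away y)) with hT
  have hJT : J ≤ T := Ideal.le_comap_map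
  have hyT : ∀ z, y * z ∈ T → z ∈ T := by
    intro z hz
    rw [hT, Ideal.mem_comap] at hz ⊢
    rw [map_mul] at hz
    exact (Ideal.unit_mul_mem_iff_mem _ (IsLocalization.Away.algebraMap_isUnit y)).1 hz
  have hym : y ∈ (HomogeneousIdeal.irrelevant 𝒜).toIdeal := HomogeneousIdeal.mem_irrelevant_of_mem 𝒜 ha hy
  by_contra hxT
  -- An associated prime of `R ⧸ T` containing the annihilator of `x`. It is homogeneous and misses
  -- `y`, because `T` is saturated. So it is not irrelevant and must be minimal over `J`, where the
  -- multiplier `s` of `x` gives a contradiction.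
  obtain ⟨Q, hQ, hxQ⟩ := exists_le_isAssociatedPrime_of_isNoetherianRing R
    (Ideal.Quotient.mk T x) (fun h => hxT (Ideal.Quotient.eq_zero_iff_mem.1 h))
  obtain ⟨hQp, z, hz⟩ := isAssociatedPrime_iff.1 hQ
  obtain ⟨z, rfl⟩ := Ideal.Quotient.mk_surjective z
  have hcolon : ∀ s u, s ∈ (⊥ : Submodule R (R ⧸ T)).colon {Ideal.Quotient.mk T u} ↔
      s * u ∈ T := by
    intro s u
    rw [Submodule.mem_colon_singleton, Submodule.mem_bot, Algebra.smul_def,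
      ← Ideal.Quotient.eq_zero_iff_mem, map_mul]
    rfl
  have hzQ : ∀ s, s ∈ Q ↔ s * z ∈ T := fun s => by rw [← hcolon, ← hz]
  have hQh := hTh.of_forall_mem_iff_mul_mem hQp z hzQ
  have hyQ : y ∉ Q := by
    intro h
    refine hQp.ne_top ((Ideal.eq_top_iff_one _).2 ((hzQ 1).2 ?_))
    rw [one_mul]
    exact hyT z ((hzQ y).1 h)
  have hJQ : J ≤ Q := fun t ht => (hzQ t).2 (T.mul_mem_right _ (hJT ht))
  obtain ⟨P, hP, hPQ⟩ := Ideal.exists_minimalPrimes_le hJQ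
  rcases hPQ.eq_or_lt with rfl | hlt
  · obtain ⟨s, hs, hsx⟩ := hx P hP fun h => hyQ (h ▸ hym)
    exact hs (hxQ ((hcolon s x).2 (hJT hsx)))
  · exact hyQ (hdim P hP Q hQp hQh hlt ▸ hym)

end Graded

/-! ### Assembly of the primary decomposition. -/

theorem mainTheorem4 {k R : Type*} [Field k] (p : ℕ) (hp : p.Prime) [CharP k p]
    [CommRing R] [Algebra k R] [Algebra.FiniteType k R]
    (𝒜 : ℕ → Submodule k R) [GradedAlgebra 𝒜]
    (h_zero : ∀ x ∈ 𝒜 0, ∃ a : k, algebraMap k R a = x)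
    (I : Ideal R) (hI : I.IsHomogeneous 𝒜)
    (h_height : (I.height : WithBot ℕ∞) + 1 = ringKrullDim R) :
    HasLinearGrowthOfPrimaryDecompositions p I := by
  have hR : IsNoetherianRing R := Algebra.FiniteType.isNoetherianRing k R
  by_cases hIt : I = ⊤
  -- The unit ideal is the empty intersection.
  · refine ⟨0, fun e => ⟨0, fun i => i.elim0, fun i => i.elim0, ?_, fun i => i.elim0⟩⟩
    rw [iInf_of_empty, Ideal.eq_top_iff_one, ← one_pow (p ^ e)]
    exact pow_mem_frobeniusPower _ (hIt ▸ Submodule.mem_top)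
  have : Nontrivial R := by
    by_contra h
    rw [not_nontrivial_iff_subsingleton] at h
    exact hIt (Subsingleton.elim _ _)
  have : Fact p.Prime := ⟨hp⟩
  have : CharP R p := charP_of_injective_algebraMap (algebraMap k R).injective p
  set M := (HomogeneousIdeal.irrelevant 𝒜).toIdeal with hM
  have hMmax : M.IsMaximal := irrelevant_isMaximal h_zero
  have hMp := hMmax.isPrime
  have hIM : I ≤ M := hI.le_irrelevant h_zero hIt
  have hq : ∀ e, 0 < p ^ e := fun e => pow_pos hp.pos e
  obtain ⟨a, ha, y, hy, hyI⟩ := exists_parameter_of_height_add_one_eq h_zero hI h_height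
  obtain ⟨n, f, d, hd0, hfd, hIf⟩ := hI.exists_eq_span_range h_zero hIt
  have hJf : ∀ e, frobeniusPower I (p ^ e) = Ideal.span (Set.range fun i => f i ^ p ^ e) := by
    intro e
    rw [hIf, frobeniusPower_span, ← Set.range_comp]
    rfl
  have hJh : ∀ e, (frobeniusPower I (p ^ e)).IsHomogeneous 𝒜 := fun e => by
    rw [hJf]
    exact Ideal.isHomogeneous_span_range fun i => SetLike.pow_mem_graded (p ^ e) (hfd i)
  obtain ⟨c₀, hc₀⟩ := exists_forall_mem_span_range_pow_of_pow_mul_mem h_zero hd0 hfd ha hy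
    (hIf ▸ hyI)
  have hfin := I.finite_minimalPrimes_of_isNoetherianRing
  let S : Set (Ideal R) := {P ∈ I.minimalPrimes | P ≠ M}
  have hSfin : Finite S := (hfin.subset fun P hP => hP.1).to_subtype
  have hSp : ∀ P : S, P.1.IsPrime := fun P => P.2.1.1.1
  choose c₁ hc₁ using fun P : S => exists_frobeniusPower_pow_le_comap_map_atPrime P.2.1
  obtain ⟨c₂, hc₂⟩ := (Set.finite_range c₁).bddAbove
  have hmin : ∀ e, (frobeniusPower I (p ^ e)).minimalPrimes = I.minimalPrimes :=
    fun e => minimalPrimes_frobeniusPower I (hq e)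
  -- `c₀` handles the torsion bound, `c₂` bounds the exponents at all minimal primes other than `M`,
  -- and `1` makes `M ^ c` a proper ideal, so that `K e` has radical `M`.
  set c := c₀ + c₂ + 1 with hc
  let K : ℕ → Ideal R := fun e => frobeniusPower I (p ^ e) ⊔ frobeniusPower (M ^ c) (p ^ e)
  have hK : ∀ e, (K e).radical = M := by
    intro e
    refine le_antisymm (hMp.radical_le_iff.2 (sup_le ?_ ?_)) fun z hz => ?_
    · exact frobeniusPower_le_iff.2 fun z hz => M.pow_mem_of_mem (hIM hz) _ (hq e)
    · exact frobeniusPower_le_iff.2 fun z hz =>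
        M.pow_mem_of_mem (Ideal.pow_le_self (Nat.succ_ne_zero _) hz) _ (hq e)
    · refine ⟨c * p ^ e, Ideal.mem_sup_right ?_⟩
      rw [pow_mul]
      exact pow_mem_frobeniusPower _ (Ideal.pow_mem_pow hz c)
  refine HasLinearGrowthOfPrimaryDecompositions.of_finite (ι := Option S) c (fun e o => o.elim (K e)
    fun P => ((frobeniusPower I (p ^ e)).map (algebraMap R (Localization.AtPrime P.1))).comap
      (algebraMap R (Localization.AtPrime P.1))) ?_ ?_ ?_
  · rintro e (_ | P)
    · refine Ideal.isPrimary_of_isMaximal_radical ?_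
      change (K e).radical.IsMaximal
      rwa [hK]
    · exact Ideal.isPrimary_comap_map_atPrime (by rw [hmin]; exact P.2.1)
  · intro e
    refine le_antisymm (le_iInf ?_) fun x hx => ?_
    · rintro (_ | P)
      · exact le_sup_left
      · exact Ideal.le_comap_map
    rw [Ideal.mem_iInf] at hx
    have hxT := mem_comap_map_away_of_forall_minimalPrimes (hJh e) (fun P hP Q hQp hQh hlt => by
      rw [hmin] at hP
      have := hP.1.1
      exact Ideal.eq_of_height_add_one_eq_ringKrullDim h_height hP.1.2 hlt
        (hQh.le_irrelevant h_zero hQp.ne_top)) ha hy (x := x) (fun P hP hPM => by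
      rw [hmin] at hP
      have := hP.1.1
      exact Ideal.mem_comap_map_atPrime_iff.1 (hx (some ⟨P, hP, hPM⟩)))
    have hTh := (hJh e).comap_map_away hy
    obtain ⟨u, hu, z, hz, rfl⟩ := Submodule.mem_sup.1 (hx none)
    have hzT := (Ideal.add_mem_iff_right _ (Ideal.le_comap_map hu)).1 hxT
    refine add_mem hu ?_
    rw [(hJh e).mem_iff]
    intro i
    -- Below degree `c * p ^ e` the component of `z` vanishes since `z ∈ M^(c q)`; from there on it
    -- is `y`-power torsion modulo `I^{[q]}`, hence lies in `I^{[q]}` by the linear bound.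
    by_cases hi : i < c * p ^ e
    · have hzM : z ∈ M ^ (c * p ^ e) := by
        refine (frobeniusPower_le_iff.2 fun v hv => ?_) hz
        rw [pow_mul]
        exact Ideal.pow_mem_pow hv _
      rw [decompose_eq_zero_of_mem_irrelevant_pow hi hzM]
      exact zero_mem _
    · obtain ⟨_, ⟨N, rfl⟩, hN⟩ := (IsLocalization.algebraMap_mem_map_algebraMap_iff
        (Submonoid.powers y) _ _ _).1 (hTh i hzT)
      rw [hJf] at hN ⊢
      refine hc₀ (p ^ e) N i _ (hq e) ?_ (SetLike.coe_mem _) hN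
      exact (Nat.mul_le_mul_right _ (by omega)).trans (not_lt.1 hi)
  · rintro e (_ | P)
    · change frobeniusPower ((K e).radical ^ c) (p ^ e) ≤ K e
      rw [hK]
      exact le_sup_right
    · have hP : P.1 ∈ (frobeniusPower I (p ^ e)).minimalPrimes := by
        rw [hmin]
        exact P.2.1
      change frobeniusPower ((Ideal.comap _ (Ideal.map _ (frobeniusPower I (p ^ e)))).radical ^ c)
        (p ^ e) ≤ Ideal.comap _ (Ideal.map _ (frobeniusPower I (p ^ e)))
      rw [Ideal.radical_comap_map_atPrime hP]
      refine hc₁ P c (p ^ e) ?_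
      have := hc₂ ⟨P, rfl⟩
      omega
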